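/- Let $I\subseteq\mathbb R$ be a (nonempty) open interval, let $(F_i,g_{F_i})$, $i=1,2,3$, be one-dimensional Riemannian manifolds, let $\phi:I\to(0,\infty)$ be smooth, and let $p_1,p_2,p_3\in\mathbb R$ be pairwise distinct. Let $M=I\times F_1\times F_2\times F_3$ with the Lorentzian metric $g=-dt^2\oplus\phi^{2p_1}g_{F_1}\oplus\phi^{2p_2}g_{F_2}\oplus\phi^{2p_3}g_{F_3}$ (a generalized Kasner space-time of type (III)), and put $\zeta=p_1+p_2+p_3$, $\eta=p_1^2+p_2^2+p_3^2$. Let $\lambda_1,\lambda_2$ be nonzero real numbers, let $P=\partial/\partial t$, $\pi(Y)=g(Y,P)$, let $\nabla$ be the Levi-Civita connection of $g$, and let $\overline\nabla$ be the quarter-symmetric connection $$\overline\nabla_XY=\nabla_XY+\lambda_1\pi(Y)X-\lambda_2\,g(X,Y)P .$$ The curvature and Ricci tensors of a connection are taken with the conventions $R(X,Y)=\nabla_X\nabla_Y-\nabla_Y\nabla_X-\nabla_{[X,Y]}$ and $\mathrm{Ric}(X,Y)=\sum_k\varepsilon_k\,g(R(X,E_k)Y,E_k)$, where $(E_k)$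 is an orthonormal basis with $g(E_k,E_k)=\varepsilon_k=\pm1$; a connection is Einstein with Einstein constant $\alpha$ if $\mathrm{Ric}=\alpha g$. Theorem 4.20. For $\alpha\in\mathbb R$, $(M,\overline\nabla)$ is Einstein with the Einstein constant $\alpha$ if and only if each $(F_i,\nabla^{F_i})$ (with its Levi-Civita connection) is Einstein with the Einstein constant $\alpha_i=0$ and one of the following conditions is satisfied: (1) $\lambda_2^2=3\lambda_1^2$, $\alpha=3\lambda_1^2-3\lambda_1\lambda_2=\lambda_2^2-3\lambda_1\lambda_2$, and $\zeta=\eta=0$; (2) $\lambda_2^2=3\lambda_1^2$, $\alpha=3\lambda_1^2-3\lambda_1\lambda_2=\lambda_2^2-3\lambda_1\lambda_2$, $\eta\neq0$, and $\phi$ is constant on $I$; (3) $\lambda_2\neq3\lambda_1$, $\alpha=0$, $\zeta\neq0$, $\dfrac{\eta}{\zeta^2}=\dfrac{3\lambda_1^2-\lambda_2^2}{(3\lambda_1-\lambda_2)^2}$, and there is a constant $c$ with $\phi(t)=c\,e^{\frac{3\lambda_1-\lambda_2}{\zeta}t}$ for all $t\in I$. -/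

import Mathlib

set_option maxSynthPendingDepth 3

open scoped Manifold ContDiff

noncomputable section

namespace QuarterSymmetric

/-! ### Connections on an open set of a vector space

A linear connection on an open set of a vector space `E` is given by its coefficients
`Γ y : E × E → E`, bilinear, through `∇_X Y = D_X Y + Γ(X, Y)`. -/

section Coordinates

/-- The bilinear form `(u, v) ↦ B(D u, D v)`. -/
def pullback {V W : Type*} [NormedAddCommGroup V] [NormedSpace ℝ V] [NormedAddCommGroup W]
    [NormedSpace ℝ W] (B : W →L[ℝ] W →L[ℝ] ℝ) (D : V →L[ℝ] W) : V →L[ℝ] V →L[ℝ] ℝ :=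
  B.bilinearComp D D

variable {E : Type*} [NormedAddCommGroup E] [NormedSpace ℝ E]

/-- The Koszul expression of a metric `G` in coordinates:
`(u, v, w) ↦ (D_u G(v, w) + D_v G(u, w) - D_w G(u, v)) / 2`. -/
def koszul (G : E → E →L[ℝ] E →L[ℝ] ℝ) (y : E) : E →L[ℝ] E →L[ℝ] E →L[ℝ] ℝ :=
  (1 / 2 : ℝ) • (fderiv ℝ G y + (fderiv ℝ G y).flip
    - ContinuousLinearMap.comp
        ((ContinuousLinearMap.flipₗᵢ ℝ E E ℝ).toContinuousLinearEquiv :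
          (E →L[ℝ] E →L[ℝ] ℝ) →L[ℝ] (E →L[ℝ] E →L[ℝ] ℝ)) (fderiv ℝ G y).flip)

theorem koszul_apply (G : E → E →L[ℝ] E →L[ℝ] ℝ) (y u v w : E) :
    koszul G y u v w =
      (fderiv ℝ G y u v w + fderiv ℝ G y v u w - fderiv ℝ G y w u v) / 2 := by
  simp [koszul]; ring

/-- The Christoffel symbols of a metric `G`, that is the coefficients of its Levi-Civita
connection: `Γ(u, v)` is the vector with `G(Γ(u, v), w) = koszul G (u, v, w)` for all `w`
(see `christoffel_spec`). -/
def christoffel (G : E → E →L[ℝ] E →L[ℝ] ℝ) (y : E) : E →L[ℝ] E →L[ℝ] E :=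
  (ContinuousLinearMap.compL ℝ E (E →L[ℝ] ℝ) E (G y).inverse) ∘L koszul G y

theorem christoffel_spec (G : E → E →L[ℝ] E →L[ℝ] ℝ) (y : E) (hG : (G y).IsInvertible)
    (u v w : E) : G y (christoffel G y u v) w = koszul G y u v w := by
  obtain ⟨e, he⟩ := hG
  simp [christoffel, ← he]

/-- The coefficients of the connection
`∇̄_X Y = ∇_X Y + l₁ π(Y) X - l₂ G(X, Y) P`, where `∇` is the Levi-Civita connection of `G` and
`π(Y) = G(Y, P)` (see `quarterCoeff_apply`). -/
def quarterCoeff (G : E → E →L[ℝ] E →L[ℝ] ℝ) (P : E → E) (l₁ l₂ : ℝ) (y : E) :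
    E →L[ℝ] E →L[ℝ] E :=
  christoffel G y
    + l₁ • (((G y).flip (P y)).smulRight (ContinuousLinearMap.id ℝ E)).flip
    - l₂ • ((ContinuousLinearMap.compL ℝ E ℝ E (ContinuousLinearMap.toSpanSingleton ℝ (P y))) ∘L
        G y)

theorem quarterCoeff_apply (G : E → E →L[ℝ] E →L[ℝ] ℝ) (P : E → E) (l₁ l₂ : ℝ) (y u v : E) :
    quarterCoeff G P l₁ l₂ y u v =
      christoffel G y u v + l₁ • (G y v (P y)) • u - l₂ • (G y u v) • P y := by
  simp [quarterCoeff]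

/-- The curvature of the connection with coefficients `Γ`, as the endomorphism
`v ↦ R(u, v) w` (see `curvature_apply`), for
`R(X, Y) = ∇_X ∇_Y - ∇_Y ∇_X - ∇_[X, Y]` (see `curvature_eq`). -/
def curvature (Γ : E → E →L[ℝ] E →L[ℝ] E) (y u w : E) : E →L[ℝ] E :=
  (fderiv ℝ Γ y u).flip w - ((fderiv ℝ Γ y).flip u).flip w
    + (Γ y u) ∘L (Γ y).flip w - (Γ y).flip (Γ y u w)

theorem curvature_apply (Γ : E → E →L[ℝ] E →L[ℝ] E) (y u v w : E) :
    curvature Γ y u w v =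
      fderiv ℝ Γ y u v w - fderiv ℝ Γ y v u w + Γ y u (Γ y v w) - Γ y v (Γ y u w) := by
  simp [curvature]

/-- The covariant derivative `∇_X Y` of the connection with coefficients `Γ`. -/
def covDeriv (Γ : E → E →L[ℝ] E →L[ℝ] E) (X Y : E → E) (y : E) : E :=
  fderiv ℝ Y y (X y) + Γ y (X y) (Y y)

/-- `curvature` is the curvature of `covDeriv` on coordinate (constant) vector fields, whose
brackets vanish. -/
theorem curvature_eq (Γ : E → E →L[ℝ] E →L[ℝ] E) (y u v w : E) (hΓ : DifferentiableAt ℝ Γ y) :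
    curvature Γ y u w v =
      covDeriv Γ (fun _ => u) (covDeriv Γ (fun _ => v) (fun _ => w)) y
        - covDeriv Γ (fun _ => v) (covDeriv Γ (fun _ => u) (fun _ => w)) y := by
  have h : ∀ a b c : E, fderiv ℝ (fun z => Γ z a b) y c = fderiv ℝ Γ y c a b := by
    intro a b c
    have h1 : HasFDerivAt (fun z => Γ z a b)
        (((ContinuousLinearMap.apply ℝ E b) ∘L (ContinuousLinearMap.apply ℝ (E →L[ℝ] E) a)) ∘L
          fderiv ℝ Γ y) y :=
      HasFDerivAt.comp (g := ((ContinuousLinearMap.apply ℝ E b) ∘L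
        (ContinuousLinearMap.apply ℝ (E →L[ℝ] E) a))) y
        (ContinuousLinearMap.hasFDerivAt _) hΓ.hasFDerivAt
    rw [h1.fderiv]; simp
  have h0 : ∀ a b : E, covDeriv Γ (fun _ => a) (fun _ => b) = fun z => Γ z a b := by
    intro a b; funext z; simp [covDeriv]
  rw [curvature_apply, h0, h0]
  simp only [covDeriv, h]
  abel

/-- The Ricci tensor `Ric(u, w) = trace (v ↦ R(u, v) w)`. This is
`∑ k, ε_k ⟨R(u, E_k) w, E_k⟩` for every orthonormal basis `E_k` of a (possibly indefinite) metric
(see `ricci_eq_sum`); the sign is the one of that sum with the above `R`. -/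
def ricci (Γ : E → E →L[ℝ] E →L[ℝ] E) (y u w : E) : ℝ :=
  LinearMap.trace ℝ E (curvature Γ y u w : E →ₗ[ℝ] E)

theorem ricci_eq_sum {ι : Type*} [Fintype ι] [DecidableEq ι] (Γ : E → E →L[ℝ] E →L[ℝ] E)
    (y u w : E) (B : E →L[ℝ] E →L[ℝ] ℝ) (b : Module.Basis ι ℝ E) (ε : ι → ℝ)
    (hε : ∀ k, ε k = 1 ∨ ε k = -1) (hb : ∀ j k, B (b j) (b k) = if j = k then ε k else 0) :
    ricci Γ y u w = ∑ k, ε k * B (curvature Γ y u w (b k)) (b k) := by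
  have h : ∀ (v : E) (k : ι), b.repr v k = ε k * B v (b k) := by
    intro v k
    conv_rhs => rw [← b.sum_repr v]
    simp only [map_sum, map_smul, sum_apply, smul_apply, hb]
    rcases hε k with h | h <;> simp [h]
  rw [ricci, LinearMap.trace_eq_matrix_trace ℝ b]
  simp [Matrix.trace, LinearMap.toMatrix_apply, h]

end Coordinates

/-! ### Connections and curvature on a manifold -/

section OnManifold

variable {E : Type*} [NormedAddCommGroup E] [NormedSpace ℝ E]
  {H : Type*} [TopologicalSpace H] (I : ModelWithCorners ℝ E H) [I.Boundaryless]
  {M : Type*} [TopologicalSpace M] [ChartedSpace H M]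

/-- The metric `g` in the preferred chart at `x`: the pullback of `g` by the inverse chart. -/
def metricInChart (g : ∀ z : M, TangentSpace I z →L[ℝ] TangentSpace I z →L[ℝ] ℝ) (x : M) (y : E) :
    E →L[ℝ] E →L[ℝ] ℝ :=
  pullback (V := E) (W := E) (g ((extChartAt I x).symm y))
    (mfderiv 𝓘(ℝ, E) I (extChartAt I x).symm y)

/-- The vector field `P` in the preferred chart at `x`. -/
def vectorInChart (P : ∀ z : M, TangentSpace I z) (x : M) (y : E) : E :=
  mfderiv I 𝓘(ℝ, E) (extChartAt I x) ((extChartAt I x).symm y) (P ((extChartAt I x).symm y))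

/-- The Levi-Civita connection of `g`, through its coefficients in the preferred charts. -/
def leviCivita (g : ∀ z : M, TangentSpace I z →L[ℝ] TangentSpace I z →L[ℝ] ℝ) (x : M) :
    E → E →L[ℝ] E →L[ℝ] E :=
  christoffel (metricInChart I g x)

/-- The connection `∇̄_X Y = ∇_X Y + l₁ π(Y) X - l₂ g(X, Y) P`, `π(Y) = g(Y, P)`, through its
coefficients in the preferred charts. -/
def quarterConnection (g : ∀ z : M, TangentSpace I z →L[ℝ] TangentSpace I z →L[ℝ] ℝ)
    (P : ∀ z : M, TangentSpace I z) (l₁ l₂ : ℝ) (x : M) : E → E →L[ℝ] E →L[ℝ] E :=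
  quarterCoeff (metricInChart I g x) (vectorInChart I P x) l₁ l₂

/-- The Ricci tensor at `x` of a connection given by its coefficients in the preferred charts,
computed in the preferred chart at `x`. -/
def ricciTensor (C : M → E → E →L[ℝ] E →L[ℝ] E) (x : M) (u w : TangentSpace I x) : ℝ :=
  ricci (C x) (extChartAt I x x) (mfderiv I 𝓘(ℝ, E) (extChartAt I x) x u)
    (mfderiv I 𝓘(ℝ, E) (extChartAt I x) x w)

/-- `(M, C)` is Einstein with the Einstein constant `α` for the metric `g`: `Ric = α g`. -/
def IsEinsteinWith (g : ∀ z : M, TangentSpace I z →L[ℝ] TangentSpace I z →L[ℝ] ℝ)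
    (C : M → E → E →L[ℝ] E →L[ℝ] E) (α : ℝ) : Prop :=
  ∀ (x : M) (u w : TangentSpace I x), ricciTensor I C x u w = α * g x u w

end OnManifold

/-! ### Generalized Kasner space-times of type (III) -/

section Kasner

/-- The model with corners of the product of four one-dimensional manifolds. -/
abbrev model4 : ModelWithCorners ℝ (ℝ × ℝ × ℝ × ℝ)
    (ModelProd ℝ (ModelProd ℝ (ModelProd ℝ ℝ))) :=
  𝓘(ℝ, ℝ).prod (𝓘(ℝ, ℝ).prod (𝓘(ℝ, ℝ).prod 𝓘(ℝ, ℝ)))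

/-- Smooth Riemannian metrics on a one-dimensional manifold `F`. -/
abbrev RiemMetric (F : Type*) [TopologicalSpace F] [ChartedSpace ℝ F] [IsManifold 𝓘(ℝ, ℝ) ∞ F] :=
  Bundle.ContMDiffRiemannianMetric 𝓘(ℝ, ℝ) ∞ ℝ (fun x : F => TangentSpace 𝓘(ℝ, ℝ) x)

variable (J : TopologicalSpace.Opens ℝ)
  {F₁ : Type*} [TopologicalSpace F₁] [ChartedSpace ℝ F₁] [IsManifold 𝓘(ℝ, ℝ) ∞ F₁]
  {F₂ : Type*} [TopologicalSpace F₂] [ChartedSpace ℝ F₂] [IsManifold 𝓘(ℝ, ℝ) ∞ F₂]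
  {F₃ : Type*} [TopologicalSpace F₃] [ChartedSpace ℝ F₃] [IsManifold 𝓘(ℝ, ℝ) ∞ F₃]

/-- The metric `-dt² + φ^(2p₁) g₁ + φ^(2p₂) g₂ + φ^(2p₃) g₃` on `J × F₁ × F₂ × F₃`; each summand is
pulled back by the corresponding projection. -/
def kasnerMetric (φ : ℝ → ℝ) (p : Fin 3 → ℝ)
    (g₁ : RiemMetric F₁) (g₂ : RiemMetric F₂) (g₃ : RiemMetric F₃) (z : J × F₁ × F₂ × F₃) :
    TangentSpace model4 z →L[ℝ] TangentSpace model4 z →L[ℝ] ℝ :=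
  -pullback (V := ℝ × ℝ × ℝ × ℝ) (W := ℝ) (ContinuousLinearMap.mul ℝ ℝ)
      (mfderiv model4 𝓘(ℝ, ℝ) (fun q : J × F₁ × F₂ × F₃ => (q.1 : ℝ)) z)
  + (φ z.1 ^ (2 * p 0)) • pullback (V := ℝ × ℝ × ℝ × ℝ) (W := ℝ) (g₁.inner z.2.1)
      (mfderiv model4 𝓘(ℝ, ℝ) (fun q : J × F₁ × F₂ × F₃ => q.2.1) z)
  + (φ z.1 ^ (2 * p 1)) • pullback (V := ℝ × ℝ × ℝ × ℝ) (W := ℝ) (g₂.inner z.2.2.1)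
      (mfderiv model4 𝓘(ℝ, ℝ) (fun q : J × F₁ × F₂ × F₃ => q.2.2.1) z)
  + (φ z.1 ^ (2 * p 2)) • pullback (V := ℝ × ℝ × ℝ × ℝ) (W := ℝ) (g₃.inner z.2.2.2)
      (mfderiv model4 𝓘(ℝ, ℝ) (fun q : J × F₁ × F₂ × F₃ => q.2.2.2) z)

/-- The vector field `∂/∂t` on `J × F₁ × F₂ × F₃`. Tangent vectors are written in the preferred
(product) chart, whose first component is the inclusion `J → ℝ`. -/
def ddt (z : J × F₁ × F₂ × F₃) : TangentSpace model4 z :=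
  ((1, 0, 0, 0) : ℝ × ℝ × ℝ × ℝ)

end Kasner

end QuarterSymmetric

end

/-! In a product chart the metric is `-dt² + ∑ fᵢ(t) aᵢ(xᵢ) dxᵢ²` with `fᵢ = φ ^ (2pᵢ)` and `aᵢ` the
coefficient of the `i`-th fibre metric, and `P` is the first coordinate vector. The connection
coefficients, hence the Ricci tensor, can be written out (`quarterCoeff_warpedMetric`,
`ricci_warpedCoeff`): Ricci is diagonal, and the derivatives of the `aᵢ` drop out because each fibre
is one-dimensional. For the same reason the fibre conditions always hold (`ricci_real`).

Being Einstein thus amounts to one time equation and three space equations for `u = φ'/φ` on the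
interval (`isEinsteinWith_kasner_iff`). The space equations are affine in `pᵢ`, so two distinct
exponents split them, and the system becomes (`einstein_equations_iff`) `u' + ζu² = (3l₁ - l₂)u`,
`l₂ζu = α + 3l₁l₂ - l₂²`, `ζu' + ηu² = 3l₁² - l₂²`.

Distinct exponents also force `η > 0`, so condition (1) never occurs. If `ζ ≠ 0`, the second
equation makes `u` constant, and the first leaves `u = 0` (condition (2)) or `ζu = 3l₁ - l₂`
(condition (3)). If `ζ = 0`, differentiating the third equation forces `u = 0`
(`kasner_solutions_iff`). -/

noncomputable section

namespace QuarterSymmetric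

/-! ### The ordinary differential equations for `φ'/φ` and their solutions. -/

section KasnerEquations

open Filter Topology

/-- The Einstein equations at one point, in terms of `u = φ' / φ` and its derivative `u'`. -/
theorem einstein_equations_iff {p : Fin 3 → ℝ} (hp : p 0 ≠ p 1) (l₁ l₂ α u u' : ℝ) :
    ((∑ i, (p i * u' + (p i * u) ^ 2 - l₂ * (p i * u) + l₁ * l₂ - l₁ ^ 2) = -α) ∧
      ∀ i, p i * u' + (p i * u) ^ 2 - l₁ * (p i * u) - l₂ ^ 2 + l₁ * l₂
          + (p i * u - l₂) * (∑ j, (p j * u - l₁) - (p i * u - l₁)) = -α) ↔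
    (u' + (∑ i, p i) * u ^ 2 = (3 * l₁ - l₂) * u ∧
      l₂ * (∑ i, p i) * u = α + 3 * l₁ * l₂ - l₂ ^ 2 ∧
      (∑ i, p i) * u' + (∑ i, p i ^ 2) * u ^ 2 = 3 * l₁ ^ 2 - l₂ ^ 2) := by
  simp only [Fin.sum_univ_three, Fin.forall_fin_succ, Fin.succ_zero_eq_one, Fin.succ_one_eq_two,
    IsEmpty.forall_iff, and_true]
  constructor
  · rintro ⟨h, h0, h1, -⟩
    -- The terms in `p i ^ 2` cancel in the `i`-th space equation, so the difference of two of them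
    -- is `p 0 - p 1` times this identity.
    have hX : u' + (p 0 + p 1 + p 2) * u ^ 2 = (3 * l₁ - l₂) * u := by
      refine mul_left_cancel₀ (sub_ne_zero.2 hp) ?_
      linear_combination h0 - h1
    have hY : l₂ * (p 0 + p 1 + p 2) * u = α + 3 * l₁ * l₂ - l₂ ^ 2 := by
      linear_combination p 0 * hX - h0
    exact ⟨hX, hY, by linear_combination h + hY⟩
  · rintro ⟨hX, hY, h⟩
    refine ⟨by linear_combination h - hY, ?_, ?_, ?_⟩
    · linear_combination p 0 * hX - hY
    · linear_combination p 1 * hX - hY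
    · linear_combination p 2 * hX - hY

theorem differentiableAt_deriv {q : ℝ → ℝ} {s : ℝ} (hq : ContDiffAt ℝ ∞ q s) :
    DifferentiableAt ℝ (deriv q) s :=
  (hq.derivWithin (m := ∞) (by simp)).differentiableAt (by simp)

variable {J : Set ℝ} {φ : ℝ → ℝ}

/-- The function `φ(t) exp(-κt)` has zero derivative on a connected open set, hence is constant
there. -/
theorem exists_eq_mul_exp_of_logDeriv_eq (hJo : IsOpen J) (hJ : J.OrdConnected)
    (hφ : DifferentiableOn ℝ φ J) (hφpos : ∀ t ∈ J, 0 < φ t) {κ : ℝ}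
    (h : ∀ t ∈ J, logDeriv φ t = κ) : ∃ c : ℝ, ∀ t ∈ J, φ t = c * Real.exp (κ * t) := by
  have hd : ∀ t ∈ J, HasDerivAt (fun t => φ t * Real.exp (-(κ * t))) 0 t := by
    intro t ht
    have h1 := (hφ.differentiableAt (hJo.mem_nhds ht)).hasDerivAt
    have h2 : HasDerivAt (fun t => Real.exp (-(κ * t))) (Real.exp (-(κ * t)) * -(κ * 1)) t :=
      (((hasDerivAt_id t).const_mul κ).neg).exp
    have h3 : deriv φ t = κ * φ t := by
      rw [← h t ht, logDeriv_apply, div_mul_cancel₀ _ (hφpos t ht).ne']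
    refine (h1.fun_mul h2).congr_deriv ?_
    rw [h3]; ring
  obtain ⟨c, hc⟩ := hJo.exists_is_const_of_deriv_eq_zero hJ.isPreconnected
    (fun t ht => (hd t ht).differentiableAt.differentiableWithinAt)
    (fun t ht => (hd t ht).deriv)
  refine ⟨c, fun t ht => ?_⟩
  rw [← hc t ht, mul_assoc, ← Real.exp_add]
  simp

theorem logDeriv_eq_of_eq_mul_exp (hJo : IsOpen J) (hφpos : ∀ t ∈ J, 0 < φ t) {c κ : ℝ}
    (h : ∀ t ∈ J, φ t = c * Real.exp (κ * t)) {t : ℝ} (ht : t ∈ J) :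
    logDeriv φ t = κ ∧ deriv (logDeriv φ) t = 0 := by
  have h1 : ∀ t ∈ J, logDeriv φ t = κ := by
    intro t ht
    have hev : φ =ᶠ[𝓝 t] fun t => c * Real.exp (κ * t) :=
      Filter.eventually_of_mem (hJo.mem_nhds ht) h
    have h2 : HasDerivAt (fun t => c * Real.exp (κ * t)) (c * (Real.exp (κ * t) * (κ * 1))) t :=
      (((hasDerivAt_id t).const_mul κ).exp).const_mul c
    have h3 := hφpos t ht
    rw [h t ht] at h3
    rw [logDeriv_apply, hev.deriv_eq, h2.deriv, h t ht, div_eq_iff h3.ne']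
    ring
  refine ⟨h1 t ht, ?_⟩
  have hev : logDeriv φ =ᶠ[𝓝 t] fun _ => κ := Filter.eventually_of_mem (hJo.mem_nhds ht) h1
  rw [hev.deriv_eq, deriv_const]

theorem kasner_solutions_iff (hJo : IsOpen J) (hJne : J.Nonempty) (hJ : J.OrdConnected)
    (hφ : ContDiffOn ℝ ∞ φ J) (hφpos : ∀ t ∈ J, 0 < φ t) {l₁ l₂ ζ η α : ℝ} (hl₁ : l₁ ≠ 0)
    (hl₂ : l₂ ≠ 0) (hη : 0 < η) :
    (∀ t ∈ J, deriv (logDeriv φ) t + ζ * logDeriv φ t ^ 2 = (3 * l₁ - l₂) * logDeriv φ t ∧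
      l₂ * ζ * logDeriv φ t = α + 3 * l₁ * l₂ - l₂ ^ 2 ∧
      ζ * deriv (logDeriv φ) t + η * logDeriv φ t ^ 2 = 3 * l₁ ^ 2 - l₂ ^ 2) ↔
    ((l₂ ^ 2 = 3 * l₁ ^ 2 ∧ α = 3 * l₁ ^ 2 - 3 * l₁ * l₂ ∧ α = l₂ ^ 2 - 3 * l₁ * l₂ ∧
        ζ = 0 ∧ η = 0) ∨
      (l₂ ^ 2 = 3 * l₁ ^ 2 ∧ α = 3 * l₁ ^ 2 - 3 * l₁ * l₂ ∧ α = l₂ ^ 2 - 3 * l₁ * l₂ ∧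
        η ≠ 0 ∧ ∃ c : ℝ, ∀ t ∈ J, φ t = c) ∨
      (l₂ ≠ 3 * l₁ ∧ α = 0 ∧ ζ ≠ 0 ∧
        η / ζ ^ 2 = (3 * l₁ ^ 2 - l₂ ^ 2) / (3 * l₁ - l₂) ^ 2 ∧
        ∃ c : ℝ, ∀ t ∈ J, φ t = c * Real.exp ((3 * l₁ - l₂) / ζ * t))) := by
  have hφd : DifferentiableOn ℝ φ J := hφ.differentiableOn (by simp)
  have hconst : (∀ t ∈ J, logDeriv φ t = 0) → ∃ c : ℝ, ∀ t ∈ J, φ t = c := by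
    intro h
    obtain ⟨c, hc⟩ := exists_eq_mul_exp_of_logDeriv_eq hJo hJ hφd hφpos h
    exact ⟨c, fun t ht => by simpa using hc t ht⟩
  constructor
  · intro H
    obtain ⟨t₀, ht₀⟩ := hJne
    obtain ⟨hA, hB, hC⟩ := H t₀ ht₀
    by_cases hζ : ζ = 0
    · subst hζ
      have hud : DifferentiableAt ℝ (logDeriv φ) t₀ := by
        have hat := hφ.contDiffAt (hJo.mem_nhds ht₀)
        exact (differentiableAt_deriv hat).div (hat.differentiableAt (by simp)) (hφpos _ ht₀).ne'
      -- With `ζ = 0` the third equation says that `ηu²` is constant, so `ηuu' = 0`; inserting `u' =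
      -- (3l₁ - l₂)u` gives `(3l₁ - l₂)u² = 0`.
      have hev : (fun t => η * logDeriv φ t ^ 2) =ᶠ[𝓝 t₀] fun _ => 3 * l₁ ^ 2 - l₂ ^ 2 :=
        Filter.eventually_of_mem (hJo.mem_nhds ht₀) fun t ht => by
          simpa using (H t ht).2.2
      have h1 := ((hud.hasDerivAt.pow 2).const_mul η).deriv
      have h2 := hev.deriv_eq
      rw [deriv_const] at h2
      have h3 : η * (2 * logDeriv φ t₀ * deriv (logDeriv φ) t₀) = 0 := by
        have h4 := h1.symm.trans h2
        simpa using h4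
      have h4 : (3 * l₁ - l₂) * logDeriv φ t₀ ^ 2 = 0 := by
        have : 2 * η ≠ 0 := by positivity
        refine mul_left_cancel₀ this ?_
        linear_combination h3 - 2 * η * logDeriv φ t₀ * hA
      have hl : l₂ ^ 2 = 3 * l₁ ^ 2 := by
        rcases mul_eq_zero.1 h4 with h5 | h5
        -- Here the third equation would read `ηu² = -6l₁² < 0`.
        · have : l₂ = 3 * l₁ := by linarith
          subst this
          have : 0 < l₁ ^ 2 := by positivity
          nlinarith [mul_nonneg hη.le (sq_nonneg (logDeriv φ t₀))]
        · rw [h5] at hC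
          linarith
      refine Or.inr (Or.inl ⟨hl, by linarith, by linarith, hη.ne', hconst fun t ht => ?_⟩)
      have h5 := (H t ht).2.2
      rw [hl] at h5
      have h6 : η * logDeriv φ t ^ 2 = 0 := by linarith
      exact pow_eq_zero_iff two_ne_zero |>.1 ((mul_eq_zero.1 h6).resolve_left hη.ne')
    · set κ := logDeriv φ t₀ with hκ
      -- The second equation determines `u`, since `l₂ζ ≠ 0`; hence `u' = 0` in the other two.
      have hu : ∀ t ∈ J, logDeriv φ t = κ := fun t ht =>
        mul_left_cancel₀ (mul_ne_zero hl₂ hζ) ((H t ht).2.1.trans hB.symm)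
      have hev : logDeriv φ =ᶠ[𝓝 t₀] fun _ => κ := Filter.eventually_of_mem (hJo.mem_nhds ht₀) hu
      rw [hev.deriv_eq, deriv_const] at hA hC
      by_cases hκ0 : κ = 0
      · rw [hκ0] at hu hB hC
        exact Or.inr (Or.inl ⟨by linarith, by linarith, by linarith, hη.ne', hconst hu⟩)
      · have hκζ : ζ * κ = 3 * l₁ - l₂ := mul_right_cancel₀ hκ0 (by linear_combination hA)
        have hne : 3 * l₁ - l₂ ≠ 0 := by rw [← hκζ]; exact mul_ne_zero hζ hκ0
        refine Or.inr (Or.inr ⟨fun h => hne (by rw [h, sub_self]),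
          by linear_combination l₂ * hκζ - hB, hζ, ?_, ?_⟩)
        · rw [← hκζ, div_eq_div_iff (by positivity) (by positivity)]
          linear_combination ζ ^ 2 * hC
        · rw [← hκζ, mul_div_cancel_left₀ _ hζ]
          exact exists_eq_mul_exp_of_logDeriv_eq hJo hJ hφd hφpos hu
  · rintro (⟨-, -, -, -, h⟩ | ⟨hl, -, hα, -, c, hc⟩ | ⟨hl, hα, hζ, hq, c, hc⟩) t ht
    -- Condition (1) is void because `η > 0`.
    · exact absurd h hη.ne'
    · obtain ⟨h1, h2⟩ := logDeriv_eq_of_eq_mul_exp hJo hφpos (c := c) (κ := 0)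
        (fun t ht => by simpa using hc t ht) ht
      rw [h1, h2]
      exact ⟨by ring, by linarith, by linarith⟩
    · obtain ⟨h1, h2⟩ := logDeriv_eq_of_eq_mul_exp hJo hφpos hc ht
      have hne : 3 * l₁ - l₂ ≠ 0 := fun h => hl (by linarith)
      rw [div_eq_div_iff (by positivity) (by positivity)] at hq
      rw [h1, h2, hα]
      refine ⟨by field_simp; ring, by field_simp; ring, ?_⟩
      field_simp
      linear_combination hq

end KasnerEquations

/-! ### Connection and Ricci tensor of a warped metric on `ℝ⁴`. -/

section Coordinates

open Filter Topology

/-- The time coordinate on `ℝ⁴`. -/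
abbrev timeCoord : (ℝ × ℝ × ℝ × ℝ) →L[ℝ] ℝ := ContinuousLinearMap.fst ℝ ℝ (ℝ × ℝ × ℝ)

/-- The space coordinates on `ℝ⁴`. -/
def spaceCoord : Fin 3 → (ℝ × ℝ × ℝ × ℝ) →L[ℝ] ℝ :=
  ![ContinuousLinearMap.fst ℝ ℝ (ℝ × ℝ) ∘L ContinuousLinearMap.snd ℝ ℝ (ℝ × ℝ × ℝ),
    ContinuousLinearMap.fst ℝ ℝ ℝ ∘L ContinuousLinearMap.snd ℝ ℝ (ℝ × ℝ) ∘L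
      ContinuousLinearMap.snd ℝ ℝ (ℝ × ℝ × ℝ),
    ContinuousLinearMap.snd ℝ ℝ ℝ ∘L ContinuousLinearMap.snd ℝ ℝ (ℝ × ℝ) ∘L
      ContinuousLinearMap.snd ℝ ℝ (ℝ × ℝ × ℝ)]

/-- The first vector of the standard basis of `ℝ⁴`. -/
def timeVec : ℝ × ℝ × ℝ × ℝ := (1, 0, 0, 0)

/-- The last three vectors of the standard basis of `ℝ⁴`. -/
def spaceVec : Fin 3 → ℝ × ℝ × ℝ × ℝ := ![(0, 1, 0, 0), (0, 0, 1, 0), (0, 0, 0, 1)]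

@[simp] theorem spaceCoord_zero (v : ℝ × ℝ × ℝ × ℝ) : spaceCoord 0 v = v.2.1 := rfl
@[simp] theorem spaceCoord_one (v : ℝ × ℝ × ℝ × ℝ) : spaceCoord 1 v = v.2.2.1 := rfl
@[simp] theorem spaceCoord_two (v : ℝ × ℝ × ℝ × ℝ) : spaceCoord 2 v = v.2.2.2 := rfl
@[simp] theorem spaceVec_zero : spaceVec 0 = (0, 1, 0, 0) := rfl
@[simp] theorem spaceVec_one : spaceVec 1 = (0, 0, 1, 0) := rfl
@[simp] theorem spaceVec_two : spaceVec 2 = (0, 0, 0, 1) := rfl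

theorem trace_eq_sum_coord (f : (ℝ × ℝ × ℝ × ℝ) →ₗ[ℝ] ℝ × ℝ × ℝ × ℝ) :
    LinearMap.trace ℝ _ f = timeCoord (f timeVec) + ∑ i, spaceCoord i (f (spaceVec i)) := by
  let s := Module.Basis.singleton Unit ℝ
  rw [LinearMap.trace_eq_matrix_trace ℝ (s.prod (s.prod (s.prod s)))]
  simp [Matrix.trace, LinearMap.toMatrix_apply, Fin.sum_univ_three, timeVec, s, add_assoc]
  rfl

/-- The metric `-dt² + ∑ fᵢ(t) aᵢ(xᵢ) dxᵢ²` on `ℝ⁴`. -/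
def warpedMetric (f a : Fin 3 → ℝ → ℝ) (z : ℝ × ℝ × ℝ × ℝ) :
    (ℝ × ℝ × ℝ × ℝ) →L[ℝ] (ℝ × ℝ × ℝ × ℝ) →L[ℝ] ℝ :=
  -timeCoord.smulRight timeCoord
    + ∑ i, (f i (timeCoord z) * a i (spaceCoord i z)) • (spaceCoord i).smulRight (spaceCoord i)

theorem warpedMetric_apply (f a : Fin 3 → ℝ → ℝ) (z u v : ℝ × ℝ × ℝ × ℝ) :
    warpedMetric f a z u v = -(u.1 * v.1)
      + ∑ i, f i z.1 * a i (spaceCoord i z) * (spaceCoord i u * spaceCoord i v) := by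
  simp [warpedMetric, Fin.sum_univ_three]

/-- The connection coefficients of the quarter-symmetric connection of `warpedMetric f a`, where
`h` and `k` are the halved logarithmic derivatives of `f` and `a`. -/
def warpedCoeff (f a h k : Fin 3 → ℝ → ℝ) (l₁ l₂ : ℝ) (z : ℝ × ℝ × ℝ × ℝ) :
    (ℝ × ℝ × ℝ × ℝ) →L[ℝ] (ℝ × ℝ × ℝ × ℝ) →L[ℝ] ℝ × ℝ × ℝ × ℝ :=
  (l₂ - l₁) • timeCoord.smulRight (timeCoord.smulRight timeVec)
    + ∑ i, (((h i (timeCoord z) - l₂) * (f i (timeCoord z) * a i (spaceCoord i z))) •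
          (spaceCoord i).smulRight ((spaceCoord i).smulRight timeVec)
        + h i (timeCoord z) • timeCoord.smulRight ((spaceCoord i).smulRight (spaceVec i))
        + (h i (timeCoord z) - l₁) • (spaceCoord i).smulRight (timeCoord.smulRight (spaceVec i))
        + k i (spaceCoord i z) •
          (spaceCoord i).smulRight ((spaceCoord i).smulRight (spaceVec i)))

theorem warpedCoeff_apply (f a h k : Fin 3 → ℝ → ℝ) (l₁ l₂ : ℝ) (z u v : ℝ × ℝ × ℝ × ℝ) :
    warpedCoeff f a h k l₁ l₂ z u v = ((l₂ - l₁) * (u.1 * v.1)) • timeVec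
      + ∑ i, (((h i z.1 - l₂) * (f i z.1 * a i (spaceCoord i z)) *
            (spaceCoord i u * spaceCoord i v)) • timeVec
          + (h i z.1 * (u.1 * spaceCoord i v) + (h i z.1 - l₁) * (spaceCoord i u * v.1)
            + k i (spaceCoord i z) * (spaceCoord i u * spaceCoord i v)) • spaceVec i) := by
  simp only [warpedCoeff, Fin.sum_univ_three, Prod.ext_iff]
  simp [timeVec]

theorem hasFDerivAt_comp_clm {E : Type*} [NormedAddCommGroup E] [NormedSpace ℝ E]
    {q : ℝ → ℝ} {q' : ℝ} (c : E →L[ℝ] ℝ) {z : E} (hq : HasDerivAt q q' (c z)) :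
    HasFDerivAt (fun z => q (c z)) (q' • c) z :=
  hq.comp_hasFDerivAt z c.hasFDerivAt

theorem hasFDerivAt_warpedMetric {f a : Fin 3 → ℝ → ℝ} {f' a' : Fin 3 → ℝ} {z : ℝ × ℝ × ℝ × ℝ}
    (hf : ∀ i, HasDerivAt (f i) (f' i) z.1) (ha : ∀ i, HasDerivAt (a i) (a' i) (spaceCoord i z)) :
    HasFDerivAt (warpedMetric f a)
      (∑ i, ((f i (timeCoord z)) • a' i • spaceCoord i
          + a i (spaceCoord i z) • f' i • timeCoord).smulRight
        ((spaceCoord i).smulRight (spaceCoord i))) z := by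
  unfold warpedMetric
  refine (HasFDerivAt.fun_sum fun i _ => ?_).const_add _
  exact (((hasFDerivAt_comp_clm timeCoord (hf i)).mul
    (hasFDerivAt_comp_clm (spaceCoord i) (ha i))).smul_const _)

/-- Pairing with the standard basis shows that the kernel is zero, and a finite-dimensional space
and its dual have equal dimension. Invertibility is what makes `christoffel_spec` applicable. -/
theorem isInvertible_warpedMetric {f a : Fin 3 → ℝ → ℝ} {z : ℝ × ℝ × ℝ × ℝ}
    (hf : ∀ i, f i z.1 ≠ 0) (ha : ∀ i, a i (spaceCoord i z) ≠ 0) :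
    (warpedMetric f a z).IsInvertible := by
  have hinj : Function.Injective (warpedMetric f a z) := by
    rw [injective_iff_map_eq_zero]
    intro u hu
    have h0 := DFunLike.congr_fun hu timeVec
    have h1 := fun i => DFunLike.congr_fun hu (spaceVec i)
    simp only [warpedMetric_apply, Fin.sum_univ_three] at h0 h1
    have := h1 0
    have := h1 1
    have := h1 2
    have := hf 0; have := hf 1; have := hf 2
    have := ha 0; have := ha 1; have := ha 2
    simp_all [timeVec, Prod.ext_iff]
  have hd : Module.finrank ℝ (ℝ × ℝ × ℝ × ℝ)
      = Module.finrank ℝ ((ℝ × ℝ × ℝ × ℝ) →L[ℝ] ℝ) := by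
    rw [← (LinearMap.toContinuousLinearMap (𝕜 := ℝ) (E := ℝ × ℝ × ℝ × ℝ) (F' := ℝ)).finrank_eq]
    exact (Subspace.dual_finrank_eq (K := ℝ) (V := ℝ × ℝ × ℝ × ℝ)).symm
  refine ⟨(LinearEquiv.ofInjectiveOfFinrankEq (warpedMetric f a z).toLinearMap hinj
    hd).toContinuousLinearEquiv, ?_⟩
  exact ContinuousLinearMap.ext fun _ => rfl

theorem quarterCoeff_warpedMetric {f a h k : Fin 3 → ℝ → ℝ} {z : ℝ × ℝ × ℝ × ℝ} (l₁ l₂ : ℝ)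
    (hf0 : ∀ i, f i z.1 ≠ 0) (ha0 : ∀ i, a i (spaceCoord i z) ≠ 0)
    (hf : ∀ i, HasDerivAt (f i) (2 * h i z.1 * f i z.1) z.1)
    (ha : ∀ i, HasDerivAt (a i) (2 * k i (spaceCoord i z) * a i (spaceCoord i z))
      (spaceCoord i z)) :
    quarterCoeff (warpedMetric f a) (fun _ => timeVec) l₁ l₂ z = warpedCoeff f a h k l₁ l₂ z := by
  have hG := isInvertible_warpedMetric hf0 ha0
  obtain ⟨e, he⟩ := hG
  refine ContinuousLinearMap.ext fun u => ContinuousLinearMap.ext fun v => ?_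
  -- The metric is nondegenerate, so the two vectors may be compared after lowering the index, where
  -- the Koszul expression replaces the Christoffel symbols.
  apply e.injective
  rw [← ContinuousLinearEquiv.coe_coe, he]
  refine ContinuousLinearMap.ext fun w => ?_
  rw [quarterCoeff_apply, map_sub, map_add, sub_apply,
    add_apply, christoffel_spec _ _ ⟨e, he⟩, koszul_apply,
    (hasFDerivAt_warpedMetric hf ha).fderiv, warpedCoeff_apply]
  simp [warpedMetric_apply, Fin.sum_univ_three, timeVec]
  ring

theorem hasFDerivAt_warpedCoeff {f a h k : Fin 3 → ℝ → ℝ} {f' a' h' k' : Fin 3 → ℝ}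
    {z : ℝ × ℝ × ℝ × ℝ} (l₁ l₂ : ℝ)
    (hf : ∀ i, HasDerivAt (f i) (f' i) z.1) (ha : ∀ i, HasDerivAt (a i) (a' i) (spaceCoord i z))
    (hh : ∀ i, HasDerivAt (h i) (h' i) z.1)
    (hk : ∀ i, HasDerivAt (k i) (k' i) (spaceCoord i z)) :
    HasFDerivAt (warpedCoeff f a h k l₁ l₂)
      (∑ i, ((((h i (timeCoord z) - l₂) • ((f i (timeCoord z)) • a' i • spaceCoord i
              + a i (spaceCoord i z) • f' i • timeCoord)
            + (f i (timeCoord z) * a i (spaceCoord i z)) • h' i • timeCoord).smulRight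
          ((spaceCoord i).smulRight ((spaceCoord i).smulRight timeVec))
        + (h' i • timeCoord).smulRight
          (timeCoord.smulRight ((spaceCoord i).smulRight (spaceVec i)))
        + (h' i • timeCoord).smulRight
          ((spaceCoord i).smulRight (timeCoord.smulRight (spaceVec i)))
        + (k' i • spaceCoord i).smulRight
          ((spaceCoord i).smulRight ((spaceCoord i).smulRight (spaceVec i)))))) z := by
  unfold warpedCoeff
  refine (HasFDerivAt.fun_sum fun i _ => ?_).const_add _
  have hhi := hasFDerivAt_comp_clm timeCoord (hh i)
  have hfi := hasFDerivAt_comp_clm timeCoord (hf i)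
  have hai := hasFDerivAt_comp_clm (spaceCoord i) (ha i)
  have hki := hasFDerivAt_comp_clm (spaceCoord i) (hk i)
  exact ((((((hhi.sub_const l₂).mul (hfi.mul hai)).smul_const _).add (hhi.smul_const _)).add
    ((hhi.sub_const l₁).smul_const _)).add (hki.smul_const _))

/-- The Ricci tensor of the quarter-symmetric connection of `warpedMetric f a`. -/
theorem ricci_warpedCoeff {f a h k : Fin 3 → ℝ → ℝ} {h' k' : Fin 3 → ℝ}
    {z : ℝ × ℝ × ℝ × ℝ} (l₁ l₂ : ℝ)
    (hf : ∀ i, HasDerivAt (f i) (2 * h i z.1 * f i z.1) z.1)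
    (ha : ∀ i, HasDerivAt (a i) (2 * k i (spaceCoord i z) * a i (spaceCoord i z))
      (spaceCoord i z))
    (hh : ∀ i, HasDerivAt (h i) (h' i) z.1)
    (hk : ∀ i, HasDerivAt (k i) (k' i) (spaceCoord i z)) (u w : ℝ × ℝ × ℝ × ℝ) :
    ricci (warpedCoeff f a h k l₁ l₂) z u w =
      (∑ i, (h' i + h i z.1 ^ 2 - l₂ * h i z.1 + l₁ * l₂ - l₁ ^ 2)) * (u.1 * w.1)
      - ∑ i, (h' i + h i z.1 ^ 2 - l₁ * h i z.1 - l₂ ^ 2 + l₁ * l₂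
          + (h i z.1 - l₂) * (∑ j, (h j z.1 - l₁) - (h i z.1 - l₁)))
        * (f i z.1 * a i (spaceCoord i z)) * (spaceCoord i u * spaceCoord i w) := by
  rw [ricci, trace_eq_sum_coord]
  simp only [ContinuousLinearMap.coe_coe, curvature_apply, Fin.sum_univ_three,
    (hasFDerivAt_warpedCoeff l₁ l₂ hf ha hh hk).fderiv, warpedCoeff_apply]
  simp [timeVec]
  ring

theorem ricci_congr {E : Type*} [NormedAddCommGroup E] [NormedSpace ℝ E]
    {Γ Γ' : E → E →L[ℝ] E →L[ℝ] E} {y : E} (h : Γ =ᶠ[𝓝 y] Γ') (u w : E) :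
    ricci Γ y u w = ricci Γ' y u w := by
  simp only [ricci, curvature, h.fderiv_eq, h.eq_of_nhds]

/-- The conclusion holds near `y`, not only at `y`, because curvature differentiates the
coefficients once more. -/
theorem quarterCoeff_congr {E : Type*} [NormedAddCommGroup E] [NormedSpace ℝ E]
    {G G' : E → E →L[ℝ] E →L[ℝ] ℝ} {P P' : E → E} {y : E} (l₁ l₂ : ℝ)
    (hG : G =ᶠ[𝓝 y] G') (hP : P =ᶠ[𝓝 y] P') :
    quarterCoeff G P l₁ l₂ =ᶠ[𝓝 y] quarterCoeff G' P' l₁ l₂ := by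
  filter_upwards [hG.eventuallyEq_nhds, hP] with z hz hz'
  simp only [quarterCoeff, christoffel, koszul, hz.fderiv_eq, hz.eq_of_nhds, hz']

/-- Curvature is antisymmetric, so that it vanishes in dimension one. -/
theorem ricci_real (Γ : ℝ → ℝ →L[ℝ] ℝ →L[ℝ] ℝ) (y u w : ℝ) : ricci Γ y u w = 0 := by
  have h : curvature Γ y u w = 0 := by
    refine ContinuousLinearMap.ext fun v => ?_
    have h1 : ∀ (T : ℝ →L[ℝ] ℝ →L[ℝ] ℝ) (s t : ℝ), T s t = s * t * T 1 1 := by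
      intro T s t
      conv_lhs => rw [← mul_one s, ← mul_one t, ← smul_eq_mul, ← smul_eq_mul]
      rw [map_smul, map_smul]
      simp only [smul_apply, smul_eq_mul]
      ring
    have h2 : ∀ s : ℝ, fderiv ℝ Γ y s = s • fderiv ℝ Γ y 1 := by
      intro s; rw [← map_smul, smul_eq_mul, mul_one]
    rw [curvature_apply, h2 u, h2 v]
    simp only [smul_apply, smul_eq_mul, zero_apply]
    rw [h1 (fderiv ℝ Γ y 1) v w, h1 (fderiv ℝ Γ y 1) u w, h1 (Γ y) u (Γ y v w),
      h1 (Γ y) v (Γ y u w), h1 (Γ y) v w, h1 (Γ y) u w]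
    ring
  simp [ricci, h]

end Coordinates

/-! ### Smoothness and positivity of the fibre metrics in charts. -/

section FibreMetric

variable {F : Type*} [TopologicalSpace F] [ChartedSpace ℝ F] [IsManifold 𝓘(ℝ, ℝ) ∞ F]

/-- The coordinate vector field is the constant section `1` of `Tℝ` followed by the tangent map of
the inverse chart, and both are smooth. -/
theorem tangentSection_contMDiffAt (x : F) {y : ℝ} (hy : y ∈ (extChartAt 𝓘(ℝ, ℝ) x).target) :
    ContMDiffAt 𝓘(ℝ, ℝ) (𝓘(ℝ, ℝ).prod 𝓘(ℝ, ℝ)) ∞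
      (fun s => Bundle.TotalSpace.mk' ℝ ((extChartAt 𝓘(ℝ, ℝ) x).symm s)
        (mfderiv 𝓘(ℝ, ℝ) 𝓘(ℝ, ℝ) (extChartAt 𝓘(ℝ, ℝ) x).symm s (1 : ℝ)) :
          ℝ → TangentBundle 𝓘(ℝ, ℝ) F) y := by
  have h1 := contMDiffOn_extChartAt_symm (I := 𝓘(ℝ, ℝ)) (n := ∞) x
  have hop : IsOpen (extChartAt 𝓘(ℝ, ℝ) x).target := isOpen_extChartAt_target x
  have h2 := h1.contMDiffOn_tangentMapWithin (m := ∞) (by simp) hop.uniqueMDiffOn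
  have h3 : ContMDiffAt 𝓘(ℝ, ℝ) (𝓘(ℝ, ℝ).prod 𝓘(ℝ, ℝ)) ∞
      (fun s => Bundle.TotalSpace.mk' ℝ s (1 : ℝ) : ℝ → TangentBundle 𝓘(ℝ, ℝ) ℝ) y :=
    contMDiffAt_vectorSpace_iff_contDiffAt.2 (contDiffAt_const (c := (1 : ℝ)))
  have h4 := (h2.contMDiffAt (x := Bundle.TotalSpace.mk' ℝ y (1 : ℝ)) ?_).comp y h3
  · refine h4.congr_of_eventuallyEq ?_
    filter_upwards [hop.mem_nhds hy] with s hs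
    simp only [tangentMapWithin, Function.comp_def]
    rw [mfderivWithin_of_mem_nhds (hop.mem_nhds hs)]
  · exact (FiberBundle.continuous_proj ℝ
      (TangentSpace 𝓘(ℝ, ℝ) : ℝ → Type)).continuousAt.preimage_mem_nhds (hop.mem_nhds hy)

theorem contDiffAt_metricInChart (g : RiemMetric F) (x : F) {y : ℝ}
    (hy : y ∈ (extChartAt 𝓘(ℝ, ℝ) x).target) :
    ContDiffAt ℝ ∞ (fun s => metricInChart 𝓘(ℝ, ℝ) g.inner x s (1 : ℝ) (1 : ℝ)) y := by
  have hop : IsOpen (extChartAt 𝓘(ℝ, ℝ) x).target := isOpen_extChartAt_target x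
  have h0 : ContMDiffAt 𝓘(ℝ, ℝ) 𝓘(ℝ, ℝ) ∞ (extChartAt 𝓘(ℝ, ℝ) x).symm y :=
    (contMDiffOn_extChartAt_symm x).contMDiffAt (hop.mem_nhds hy)
  have hv := tangentSection_contMDiffAt x hy
  have hg := (g.contMDiff ((extChartAt 𝓘(ℝ, ℝ) x).symm y)).comp y h0
  have := ContMDiffAt.clm_bundle_apply₂ (F₁ := ℝ) (F₂ := ℝ) (F₃ := ℝ)
    (E₁ := fun z : F => TangentSpace 𝓘(ℝ, ℝ) z) (E₂ := fun z : F => TangentSpace 𝓘(ℝ, ℝ) z)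
    (E₃ := Bundle.Trivial F ℝ) hg hv hv
  rw [Bundle.contMDiffAt_totalSpace] at this
  exact contMDiffAt_iff_contDiffAt.1 this.2

/-- The derivative of the inverse chart is invertible, so it sends `1` to a nonzero vector. -/
theorem metricInChart_pos (g : RiemMetric F) (x : F) {y : ℝ}
    (hy : y ∈ (extChartAt 𝓘(ℝ, ℝ) x).target) :
    0 < metricInChart 𝓘(ℝ, ℝ) g.inner x y (1 : ℝ) (1 : ℝ) := by
  have hinv := isInvertible_mfderivWithin_extChartAt_symm (I := 𝓘(ℝ, ℝ)) hy
  rw [ModelWithCorners.range_eq_univ, mfderivWithin_univ] at hinv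
  obtain ⟨e, he⟩ := hinv
  refine g.pos _ _ ?_
  rw [← he]
  exact fun h => one_ne_zero (α := ℝ) (e.map_eq_zero_iff.1 h)

theorem isEinsteinWith_leviCivita_real (g : RiemMetric F) :
    IsEinsteinWith 𝓘(ℝ, ℝ) g.inner (leviCivita 𝓘(ℝ, ℝ) g.inner) 0 := by
  intro x u w
  rw [zero_mul]
  exact ricci_real _ _ _ _

end FibreMetric

/-! ### Passing from tensors on a manifold to coordinate expressions. -/

section Product

variable {E : Type*} [NormedAddCommGroup E] [NormedSpace ℝ E]
  {H : Type*} [TopologicalSpace H] (I : ModelWithCorners ℝ E H) [I.Boundaryless]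
  {M : Type*} [TopologicalSpace M] [ChartedSpace H M] [IsManifold I 1 M]

/-- At the centre of its preferred chart, the chart and its inverse have the identity as derivative,
so tensors there coincide with their coordinate expressions. -/
theorem isEinsteinWith_iff (g : ∀ z : M, TangentSpace I z →L[ℝ] TangentSpace I z →L[ℝ] ℝ)
    (C : M → E → E →L[ℝ] E →L[ℝ] E) (α : ℝ) :
    IsEinsteinWith I g C α ↔ ∀ (x : M) (u w : E), ricci (C x) (extChartAt I x x) u w
      = α * metricInChart I g x (extChartAt I x x) u w := by
  refine forall_congr' fun x => ?_
  have h1 := mfderivWithin_range_extChartAt_symm (I := I) (x := x)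
  rw [ModelWithCorners.range_eq_univ, mfderivWithin_univ] at h1
  have h2 : ∀ u w : E, metricInChart I g x (extChartAt I x x) u w
      = (g x : E →L[ℝ] E →L[ℝ] ℝ) u w := by
    intro u w
    have h3 := extChartAt_to_inv (I := I) x
    unfold metricInChart
    rw [h1]
    show (g ((extChartAt I x).symm (extChartAt I x x)) : E →L[ℝ] E →L[ℝ] ℝ) u w = _
    rw [h3]
  simp only [h2, ricciTensor, mfderiv_extChartAt_self]
  rfl

theorem pullback_mfderiv_comp {E' H' N : Type*} [NormedAddCommGroup E'] [NormedSpace ℝ E']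
    [TopologicalSpace H'] (I' : ModelWithCorners ℝ E' H') [TopologicalSpace N]
    [ChartedSpace H' N] {f : M → N} (x : M) {y : E} (hy : y ∈ (extChartAt I x).target)
    (hf : MDifferentiableAt I I' f ((extChartAt I x).symm y)) (B : E' →L[ℝ] E' →L[ℝ] ℝ) :
    pullback (V := E) (W := E) (pullback (V := E) (W := E') B
      (mfderiv I I' f ((extChartAt I x).symm y))) (mfderiv 𝓘(ℝ, E) I (extChartAt I x).symm y)
      = pullback (V := E) (W := E') B (mfderiv 𝓘(ℝ, E) I' (f ∘ (extChartAt I x).symm) y) := by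
  have h := mdifferentiableWithinAt_extChartAt_symm (I := I) hy
  rw [ModelWithCorners.range_eq_univ, mdifferentiableWithinAt_univ] at h
  rw [mfderiv_comp y hf h]
  rfl

end Product

/-! ### The Kasner metric and `∂/∂t` in product charts. -/

section KasnerChart

open Filter Topology

variable (J : TopologicalSpace.Opens ℝ)

theorem extChartAt_opens_symm_apply (x : J) {t : ℝ} (ht : t ∈ (extChartAt 𝓘(ℝ, ℝ) x).target) :
    ((extChartAt 𝓘(ℝ, ℝ) x).symm t : ℝ) = t :=
  (extChartAt 𝓘(ℝ, ℝ) x).right_inv ht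

theorem mdifferentiable_opens_coe : MDifferentiable 𝓘(ℝ, ℝ) 𝓘(ℝ, ℝ) (fun q : J => (q : ℝ)) :=
  (contMDiff_subtype_val (n := 1)).mdifferentiable one_ne_zero

/-- The inclusion of `J` is itself the preferred chart at `x`. -/
theorem mfderiv_opens_coe (x : J) :
    mfderiv 𝓘(ℝ, ℝ) 𝓘(ℝ, ℝ) (fun q : J => (q : ℝ)) x = ContinuousLinearMap.id ℝ ℝ :=
  mfderiv_extChartAt_self (I := 𝓘(ℝ, ℝ)) (x := x)

variable {F₁ F₂ F₃ : Type*} [TopologicalSpace F₁] [ChartedSpace ℝ F₁]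
  [TopologicalSpace F₂] [ChartedSpace ℝ F₂] [TopologicalSpace F₃] [ChartedSpace ℝ F₃]

theorem extChartAt_model4 (x : J × F₁ × F₂ × F₃) :
    extChartAt model4 x = (extChartAt 𝓘(ℝ, ℝ) x.1).prod ((extChartAt 𝓘(ℝ, ℝ) x.2.1).prod
      ((extChartAt 𝓘(ℝ, ℝ) x.2.2.1).prod (extChartAt 𝓘(ℝ, ℝ) x.2.2.2))) := by
  rw [extChartAt_prod, extChartAt_prod, extChartAt_prod]

variable [IsManifold 𝓘(ℝ, ℝ) ∞ F₁] [IsManifold 𝓘(ℝ, ℝ) ∞ F₂] [IsManifold 𝓘(ℝ, ℝ) ∞ F₃]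

/-- The coefficients of the fibre metrics in the preferred charts. -/
def fibreCoeff (g₁ : RiemMetric F₁) (g₂ : RiemMetric F₂) (g₃ : RiemMetric F₃)
    (x : J × F₁ × F₂ × F₃) : Fin 3 → ℝ → ℝ :=
  ![fun s => metricInChart 𝓘(ℝ, ℝ) g₁.inner x.2.1 s (1 : ℝ) (1 : ℝ),
    fun s => metricInChart 𝓘(ℝ, ℝ) g₂.inner x.2.2.1 s (1 : ℝ) (1 : ℝ),
    fun s => metricInChart 𝓘(ℝ, ℝ) g₃.inner x.2.2.2 s (1 : ℝ) (1 : ℝ)]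

theorem pullback_inner_eq {F : Type*} [TopologicalSpace F] [ChartedSpace ℝ F]
    [IsManifold 𝓘(ℝ, ℝ) ∞ F] (g : RiemMetric F) (x : F)
    {E : Type*} [NormedAddCommGroup E] [NormedSpace ℝ E] (c : E →L[ℝ] ℝ) {y : E}
    (hy : c y ∈ (extChartAt 𝓘(ℝ, ℝ) x).target) :
    pullback (V := E) (W := ℝ) (g.inner ((extChartAt 𝓘(ℝ, ℝ) x).symm (c y)))
      (mfderiv 𝓘(ℝ, E) 𝓘(ℝ, ℝ) ((extChartAt 𝓘(ℝ, ℝ) x).symm ∘ c) y)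
      = metricInChart 𝓘(ℝ, ℝ) g.inner x (c y) (1 : ℝ) (1 : ℝ) • c.smulRight c := by
  have h := mdifferentiableWithinAt_extChartAt_symm (I := 𝓘(ℝ, ℝ)) hy
  rw [ModelWithCorners.range_eq_univ, mdifferentiableWithinAt_univ] at h
  have hc : MDifferentiableAt 𝓘(ℝ, E) 𝓘(ℝ, ℝ) c y := c.differentiableAt.mdifferentiableAt
  rw [mfderiv_comp y h hc, mfderiv_eq_fderiv, c.fderiv]
  refine ContinuousLinearMap.ext fun u => ContinuousLinearMap.ext fun v => ?_
  have h1 : ∀ (T : ℝ →L[ℝ] ℝ →L[ℝ] ℝ) (s t : ℝ), T s t = T 1 1 * (s * t) := by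
    intro T s t
    conv_lhs => rw [← mul_one s, ← mul_one t, ← smul_eq_mul, ← smul_eq_mul]
    rw [map_smul, map_smul]
    simp only [smul_apply, smul_eq_mul]
    ring
  exact h1 (metricInChart 𝓘(ℝ, ℝ) g.inner x (c y)) (c u) (c v)

/-- Each summand is a pullback by a projection, and the chain rule turns it into a pullback by a
coordinate function. The identity is needed on the whole chart target, since the Ricci tensor
involves second derivatives of the metric. -/
theorem metricInChart_kasnerMetric (φ : ℝ → ℝ) (p : Fin 3 → ℝ)
    (g₁ : RiemMetric F₁) (g₂ : RiemMetric F₂) (g₃ : RiemMetric F₃) (x : J × F₁ × F₂ × F₃)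
    {y : ℝ × ℝ × ℝ × ℝ} (hy : y ∈ (extChartAt model4 x).target) :
    metricInChart model4 (kasnerMetric J φ p g₁ g₂ g₃) x y
      = warpedMetric (fun i t => φ t ^ (2 * p i)) (fibreCoeff J g₁ g₂ g₃ x) y := by
  have hy' := hy
  rw [extChartAt_model4] at hy'
  obtain ⟨hy0, hy1, hy2, hy3⟩ := hy'
  set z := (extChartAt model4 x).symm y with hz
  have hz0 : (z.1 : ℝ) = y.1 := by
    rw [hz, extChartAt_model4]; exact extChartAt_opens_symm_apply J x.1 hy0
  have hf0 : MDifferentiableAt model4 𝓘(ℝ, ℝ) (fun q : J × F₁ × F₂ × F₃ => (q.1 : ℝ)) z :=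
    (mdifferentiable_opens_coe J _).comp z mdifferentiableAt_fst
  have hf1 : MDifferentiableAt model4 𝓘(ℝ, ℝ) (fun q : J × F₁ × F₂ × F₃ => q.2.1) z :=
    mdifferentiableAt_fst.comp z mdifferentiableAt_snd
  have hf2 : MDifferentiableAt model4 𝓘(ℝ, ℝ) (fun q : J × F₁ × F₂ × F₃ => q.2.2.1) z :=
    mdifferentiableAt_fst.comp z (mdifferentiableAt_snd.comp z mdifferentiableAt_snd)
  have hf3 : MDifferentiableAt model4 𝓘(ℝ, ℝ) (fun q : J × F₁ × F₂ × F₃ => q.2.2.2) z :=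
    mdifferentiableAt_snd.comp z (mdifferentiableAt_snd.comp z mdifferentiableAt_snd)
  have key0 := pullback_mfderiv_comp model4 𝓘(ℝ, ℝ) x hy hf0 (ContinuousLinearMap.mul ℝ ℝ)
  have key1 := pullback_mfderiv_comp model4 𝓘(ℝ, ℝ) x hy hf1 (g₁.inner z.2.1)
  have key2 := pullback_mfderiv_comp model4 𝓘(ℝ, ℝ) x hy hf2 (g₂.inner z.2.2.1)
  have key3 := pullback_mfderiv_comp model4 𝓘(ℝ, ℝ) x hy hf3 (g₃.inner z.2.2.2)
  have c1 : (fun q : J × F₁ × F₂ × F₃ => q.2.1) ∘ (extChartAt model4 x).symm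
      = (extChartAt 𝓘(ℝ, ℝ) x.2.1).symm ∘ spaceCoord 0 := by
    rw [extChartAt_model4]; rfl
  have c2 : (fun q : J × F₁ × F₂ × F₃ => q.2.2.1) ∘ (extChartAt model4 x).symm
      = (extChartAt 𝓘(ℝ, ℝ) x.2.2.1).symm ∘ spaceCoord 1 := by
    rw [extChartAt_model4]; rfl
  have c3 : (fun q : J × F₁ × F₂ × F₃ => q.2.2.2) ∘ (extChartAt model4 x).symm
      = (extChartAt 𝓘(ℝ, ℝ) x.2.2.2).symm ∘ spaceCoord 2 := by
    rw [extChartAt_model4]; rfl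
  -- Only local equality is available here: the inverse chart of `J` inverts the inclusion only on
  -- the chart target.
  have c0 : (fun q : J × F₁ × F₂ × F₃ => (q.1 : ℝ)) ∘ (extChartAt model4 x).symm
      =ᶠ[𝓝 y] timeCoord := by
    filter_upwards [(isOpen_extChartAt_target x).mem_nhds hy] with w hw
    rw [extChartAt_model4] at hw ⊢
    exact extChartAt_opens_symm_apply J x.1 hw.1
  have z1 : z.2.1 = (extChartAt 𝓘(ℝ, ℝ) x.2.1).symm (spaceCoord 0 y) := congrFun c1 y
  have z2 : z.2.2.1 = (extChartAt 𝓘(ℝ, ℝ) x.2.2.1).symm (spaceCoord 1 y) := congrFun c2 y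
  have z3 : z.2.2.2 = (extChartAt 𝓘(ℝ, ℝ) x.2.2.2).symm (spaceCoord 2 y) := congrFun c3 y
  rw [c1] at key1
  rw [c2] at key2
  rw [c3] at key3
  have e1 := pullback_inner_eq g₁ x.2.1 (spaceCoord 0) (y := y) hy1
  have e2 := pullback_inner_eq g₂ x.2.2.1 (spaceCoord 1) (y := y) hy2
  have e3 := pullback_inner_eq g₃ x.2.2.2 (spaceCoord 2) (y := y) hy3
  rw [← z1] at e1
  rw [← z2] at e2
  rw [← z3] at e3
  rw [c0.mfderiv_eq, mfderiv_eq_fderiv, timeCoord.fderiv] at key0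
  refine ContinuousLinearMap.ext fun u => ContinuousLinearMap.ext fun v => ?_
  have k0 := DFunLike.congr_fun (DFunLike.congr_fun key0 u) v
  have k1 := DFunLike.congr_fun (DFunLike.congr_fun (key1.trans e1) u) v
  have k2 := DFunLike.congr_fun (DFunLike.congr_fun (key2.trans e2) u) v
  have k3 := DFunLike.congr_fun (DFunLike.congr_fun (key3.trans e3) u) v
  rw [warpedMetric_apply, Fin.sum_univ_three, ← hz0]
  refine (congrArg₂ (· + ·) (congrArg₂ (· + ·) (congrArg₂ (· + ·) (congrArg Neg.neg k0)
    (congrArg (φ z.1 ^ (2 * p 0) * ·) k1)) (congrArg (φ z.1 ^ (2 * p 1) * ·) k2))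
    (congrArg (φ z.1 ^ (2 * p 2) * ·) k3)).trans ?_
  simp only [pullback, fibreCoeff, smul_apply, ContinuousLinearMap.smulRight_apply, smul_eq_mul]
  simp
  ring

/-- `ddt` at `z` is written in the chart at `z`, while this concerns the chart at `x`. Both are
product charts with the inclusion as time coordinate, so the change of chart fixes `∂/∂t`: the space
coordinates factor through `Prod.snd`, whose derivative kills it. -/
theorem vectorInChart_ddt (x : J × F₁ × F₂ × F₃) {y : ℝ × ℝ × ℝ × ℝ}
    (hy : y ∈ (extChartAt model4 x).target) :
    vectorInChart model4 (ddt J (F₁ := F₁) (F₂ := F₂) (F₃ := F₃)) x y = timeVec := by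
  have hz := (extChartAt model4 x).map_target hy
  unfold vectorInChart
  set z := (extChartAt model4 x).symm y
  have hz' := hz
  rw [extChartAt_model4] at hz'
  obtain ⟨-, hz1, hz2, hz3⟩ := hz'
  rw [extChartAt_source] at hz1 hz2 hz3 hz
  have he : MDifferentiableAt model4 𝓘(ℝ, ℝ × ℝ × ℝ × ℝ) (extChartAt model4 x) z :=
    mdifferentiableAt_extChartAt hz
  have hc : ∀ (c : (ℝ × ℝ × ℝ × ℝ) →L[ℝ] ℝ) (v : ℝ × ℝ × ℝ × ℝ),
      c (mfderiv model4 𝓘(ℝ, ℝ × ℝ × ℝ × ℝ) (extChartAt model4 x) z v)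
        = mfderiv model4 𝓘(ℝ, ℝ) (c ∘ extChartAt model4 x) z v := by
    intro c v
    have h : MDifferentiableAt 𝓘(ℝ, ℝ × ℝ × ℝ × ℝ) 𝓘(ℝ, ℝ) c (extChartAt model4 x z) :=
      c.differentiableAt.mdifferentiableAt
    rw [mfderiv_comp z h he, mfderiv_eq_fderiv, c.fderiv]
    rfl
  have e0 : timeCoord ∘ extChartAt model4 x
      = (fun q : J => (q : ℝ)) ∘ (Prod.fst : J × F₁ × F₂ × F₃ → J) := by
    rw [extChartAt_model4]; rfl
  have e1 : spaceCoord 0 ∘ extChartAt model4 x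
      = extChartAt 𝓘(ℝ, ℝ) x.2.1 ∘ (Prod.fst ∘ (Prod.snd : J × F₁ × F₂ × F₃ → _)) := by
    rw [extChartAt_model4]; rfl
  have e2 : spaceCoord 1 ∘ extChartAt model4 x = extChartAt 𝓘(ℝ, ℝ) x.2.2.1 ∘
      (Prod.fst ∘ Prod.snd ∘ (Prod.snd : J × F₁ × F₂ × F₃ → _)) := by
    rw [extChartAt_model4]; rfl
  have e3 : spaceCoord 2 ∘ extChartAt model4 x = extChartAt 𝓘(ℝ, ℝ) x.2.2.2 ∘
      (Prod.snd ∘ Prod.snd ∘ (Prod.snd : J × F₁ × F₂ × F₃ → _)) := by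
    rw [extChartAt_model4]; rfl
  have hfst : mfderiv model4 (𝓘(ℝ, ℝ)) (Prod.fst : J × F₁ × F₂ × F₃ → J) z
      = ContinuousLinearMap.fst ℝ ℝ (ℝ × ℝ × ℝ) := mfderiv_fst
  have hsnd : mfderiv model4 (𝓘(ℝ, ℝ).prod (𝓘(ℝ, ℝ).prod 𝓘(ℝ, ℝ)))
      (Prod.snd : J × F₁ × F₂ × F₃ → _) z = ContinuousLinearMap.snd ℝ ℝ (ℝ × ℝ × ℝ) := mfderiv_snd
  have h0 := hc timeCoord (1, 0, 0, 0)
  rw [e0, mfderiv_comp z (mdifferentiable_opens_coe J _) mdifferentiableAt_fst,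
    mfderiv_opens_coe, hfst] at h0
  have hspace : ∀ i, spaceCoord i (mfderiv model4 𝓘(ℝ, ℝ × ℝ × ℝ × ℝ) (extChartAt model4 x) z
      ((1, 0, 0, 0) : ℝ × ℝ × ℝ × ℝ)) = 0 := by
    have hd : MDifferentiableAt model4 (𝓘(ℝ, ℝ).prod (𝓘(ℝ, ℝ).prod 𝓘(ℝ, ℝ)))
      (Prod.snd : J × F₁ × F₂ × F₃ → _) z := mdifferentiableAt_snd
    have hcongr : ∀ (f f' : J × F₁ × F₂ × F₃ → ℝ) (_ : f = f') (v : ℝ × ℝ × ℝ × ℝ),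
        (mfderiv model4 𝓘(ℝ, ℝ) f z v : ℝ) = mfderiv model4 𝓘(ℝ, ℝ) f' z v := by
      rintro f _ rfl v; rfl
    have hzero : ∀ (A : ℝ →L[ℝ] ℝ) (B : (ℝ × ℝ × ℝ) →L[ℝ] ℝ),
        (A ∘L B ∘L ContinuousLinearMap.snd ℝ ℝ (ℝ × ℝ × ℝ)) (1, 0, 0, 0) = 0 := by
      intro A B
      exact (congrArg A (map_zero B)).trans (map_zero A)
    intro i
    rw [hc]
    fin_cases i
    · have h := mfderiv_comp z (mdifferentiableAt_extChartAt hz1)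
        (mdifferentiableAt_fst.comp z hd)
      rw [mfderiv_comp z mdifferentiableAt_fst hd, hsnd] at h
      refine (hcongr _ _ e1 _).trans
        ((DFunLike.congr_fun h ((1, 0, 0, 0) : ℝ × ℝ × ℝ × ℝ)).trans ?_)
      exact hzero _ _
    · have h := mfderiv_comp z (mdifferentiableAt_extChartAt hz2)
        ((mdifferentiableAt_fst.comp z.2 mdifferentiableAt_snd).comp z hd)
      rw [mfderiv_comp z (mdifferentiableAt_fst.comp z.2 mdifferentiableAt_snd) hd, hsnd] at h
      refine (hcongr _ _ e2 _).trans
        ((DFunLike.congr_fun h ((1, 0, 0, 0) : ℝ × ℝ × ℝ × ℝ)).trans ?_)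
      exact hzero _ _
    · have h := mfderiv_comp z (mdifferentiableAt_extChartAt hz3)
        ((mdifferentiableAt_snd.comp z.2 mdifferentiableAt_snd).comp z hd)
      rw [mfderiv_comp z (mdifferentiableAt_snd.comp z.2 mdifferentiableAt_snd) hd, hsnd] at h
      refine (hcongr _ _ e3 _).trans
        ((DFunLike.congr_fun h ((1, 0, 0, 0) : ℝ × ℝ × ℝ × ℝ)).trans ?_)
      exact hzero _ _
  exact Prod.ext h0 (Prod.ext (hspace 0) (Prod.ext (hspace 1) (hspace 2)))

end KasnerChart

/-! ### The Ricci tensor of the Kasner space-time and its Einstein equations. -/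

section KasnerRicci

open Filter Topology

theorem hasDerivAt_rpow_two_mul {φ : ℝ → ℝ} {t r : ℝ} (hφ : DifferentiableAt ℝ φ t)
    (h0 : 0 < φ t) :
    HasDerivAt (fun t => φ t ^ (2 * r)) (2 * (r * logDeriv φ t) * φ t ^ (2 * r)) t := by
  convert hφ.hasDerivAt.rpow_const (p := 2 * r) (Or.inl h0.ne') using 1
  rw [Real.rpow_sub_one h0.ne', logDeriv_apply]
  field_simp

variable (J : TopologicalSpace.Opens ℝ)
  {F₁ : Type*} [TopologicalSpace F₁] [ChartedSpace ℝ F₁] [IsManifold 𝓘(ℝ, ℝ) ∞ F₁]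
  {F₂ : Type*} [TopologicalSpace F₂] [ChartedSpace ℝ F₂] [IsManifold 𝓘(ℝ, ℝ) ∞ F₂]
  {F₃ : Type*} [TopologicalSpace F₃] [ChartedSpace ℝ F₃] [IsManifold 𝓘(ℝ, ℝ) ∞ F₃]

theorem contDiffAt_fibreCoeff_and_pos (g₁ : RiemMetric F₁) (g₂ : RiemMetric F₂)
    (g₃ : RiemMetric F₃) (x : J × F₁ × F₂ × F₃) {z : ℝ × ℝ × ℝ × ℝ}
    (hz : z ∈ (extChartAt model4 x).target) (i : Fin 3) :
    ContDiffAt ℝ ∞ (fibreCoeff J g₁ g₂ g₃ x i) (spaceCoord i z) ∧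
      0 < fibreCoeff J g₁ g₂ g₃ x i (spaceCoord i z) := by
  rw [extChartAt_model4] at hz
  obtain ⟨-, hz1, hz2, hz3⟩ := hz
  fin_cases i
  · exact ⟨contDiffAt_metricInChart g₁ x.2.1 hz1, metricInChart_pos g₁ x.2.1 hz1⟩
  · exact ⟨contDiffAt_metricInChart g₂ x.2.2.1 hz2, metricInChart_pos g₂ x.2.2.1 hz2⟩
  · exact ⟨contDiffAt_metricInChart g₃ x.2.2.2 hz3, metricInChart_pos g₃ x.2.2.2 hz3⟩

theorem ricci_quarterConnection_kasner {φ : ℝ → ℝ} (hφ : ContDiffOn ℝ ∞ φ J)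
    (hφpos : ∀ t ∈ J, 0 < φ t) (p : Fin 3 → ℝ)
    (g₁ : RiemMetric F₁) (g₂ : RiemMetric F₂) (g₃ : RiemMetric F₃) (l₁ l₂ : ℝ)
    (x : J × F₁ × F₂ × F₃) (u w : ℝ × ℝ × ℝ × ℝ) :
    ricci (quarterConnection model4 (kasnerMetric J φ p g₁ g₂ g₃) (ddt J) l₁ l₂ x)
      (extChartAt model4 x x) u w =
      (∑ i, (p i * deriv (logDeriv φ) x.1 + (p i * logDeriv φ x.1) ^ 2
          - l₂ * (p i * logDeriv φ x.1) + l₁ * l₂ - l₁ ^ 2)) * (u.1 * w.1)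
      - ∑ i, (p i * deriv (logDeriv φ) x.1 + (p i * logDeriv φ x.1) ^ 2
          - l₁ * (p i * logDeriv φ x.1) - l₂ ^ 2 + l₁ * l₂
          + (p i * logDeriv φ x.1 - l₂)
            * (∑ j, (p j * logDeriv φ x.1 - l₁) - (p i * logDeriv φ x.1 - l₁)))
        * (φ x.1 ^ (2 * p i) * fibreCoeff J g₁ g₂ g₃ x i (spaceCoord i (extChartAt model4 x x)))
        * (spaceCoord i u * spaceCoord i w) := by
  set y := extChartAt model4 x x with hy
  have hmem : y ∈ (extChartAt model4 x).target := mem_extChartAt_target x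
  have hy1 : y.1 = x.1 := by rw [hy, extChartAt_model4]; rfl
  have htarget : ∀ᶠ z in 𝓝 y, z ∈ (extChartAt model4 x).target :=
    (isOpen_extChartAt_target x).mem_nhds hmem
  have hJ : ∀ᶠ t in 𝓝 y.1, t ∈ J := J.isOpen.mem_nhds (by rw [hy1]; exact x.1.2)
  set a := fibreCoeff J g₁ g₂ g₃ x with ha_def
  have hφat : ∀ t ∈ J, ContDiffAt ℝ ∞ φ t := fun t ht => hφ.contDiffAt (J.isOpen.mem_nhds ht)
  have hasmooth : ∀ z ∈ (extChartAt model4 x).target, ∀ i,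
      ContDiffAt ℝ ∞ (a i) (spaceCoord i z) ∧ 0 < a i (spaceCoord i z) := fun z hz i =>
    contDiffAt_fibreCoeff_and_pos J g₁ g₂ g₃ x hz i
  -- Half the logarithmic derivative of `a i`, as `warpedCoeff` expects; likewise `h` below is half
  -- that of `φ ^ (2 * p i)`.
  set k : Fin 3 → ℝ → ℝ := fun i s => deriv (a i) s / (2 * a i s) with hk
  have hka : ∀ z ∈ (extChartAt model4 x).target, ∀ i,
      HasDerivAt (a i) (2 * k i (spaceCoord i z) * a i (spaceCoord i z)) (spaceCoord i z) := by
    intro z hz i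
    obtain ⟨h1, h2⟩ := hasmooth z hz i
    refine (h1.differentiableAt (by simp)).hasDerivAt.congr_deriv ?_
    change _ = 2 * (deriv (a i) (spaceCoord i z) / (2 * a i (spaceCoord i z))) * _
    field_simp
  have hkd : ∀ i, DifferentiableAt ℝ (k i) (spaceCoord i y) := by
    intro i
    obtain ⟨h1, h2⟩ := hasmooth y hmem i
    have h3 : DifferentiableAt ℝ (deriv (a i)) (spaceCoord i y) :=
      differentiableAt_deriv h1
    exact h3.div ((h1.differentiableAt (by simp)).const_mul 2) (by positivity)
  set h : Fin 3 → ℝ → ℝ := fun i t => p i * logDeriv φ t with hh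
  have hf : ∀ t ∈ J, ∀ i, HasDerivAt (fun t => φ t ^ (2 * p i))
      (2 * h i t * φ t ^ (2 * p i)) t := fun t ht i =>
    hasDerivAt_rpow_two_mul ((hφat t ht).differentiableAt (by simp)) (hφpos t ht)
  have hhd : ∀ i, HasDerivAt (h i) (p i * deriv (logDeriv φ) y.1) y.1 := by
    intro i
    have hyJ := hJ.self_of_nhds
    have h3 : DifferentiableAt ℝ (deriv φ) y.1 :=
      differentiableAt_deriv (hφat _ hyJ)
    exact (h3.div ((hφat _ hyJ).differentiableAt (by simp))
      (hφpos _ hyJ).ne').hasDerivAt.const_mul _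
  have hΓ : quarterConnection model4 (kasnerMetric J φ p g₁ g₂ g₃) (ddt J) l₁ l₂ x
      =ᶠ[𝓝 y] warpedCoeff (fun i t => φ t ^ (2 * p i)) a h k l₁ l₂ := by
    refine (quarterCoeff_congr l₁ l₂ (htarget.mono fun z hz =>
      metricInChart_kasnerMetric J φ p g₁ g₂ g₃ x hz)
      (htarget.mono fun z hz => vectorInChart_ddt J x hz)).trans ?_
    filter_upwards [htarget, continuous_fst.continuousAt.eventually hJ] with z hz hzJ
    exact quarterCoeff_warpedMetric l₁ l₂ (fun i => (Real.rpow_pos_of_pos (hφpos _ hzJ) _).ne')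
      (fun i => (hasmooth z hz i).2.ne') (hf _ hzJ) (hka z hz)
  rw [ricci_congr hΓ, ricci_warpedCoeff l₁ l₂ (hf _ hJ.self_of_nhds) (hka y hmem) hhd
    (fun i => (hkd i).hasDerivAt), hy1]

theorem isEinsteinWith_kasner_iff [Nonempty F₁] [Nonempty F₂] [Nonempty F₃] {φ : ℝ → ℝ}
    (hφ : ContDiffOn ℝ ∞ φ J) (hφpos : ∀ t ∈ J, 0 < φ t) (p : Fin 3 → ℝ)
    (g₁ : RiemMetric F₁) (g₂ : RiemMetric F₂) (g₃ : RiemMetric F₃) (l₁ l₂ α : ℝ) :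
    IsEinsteinWith model4 (kasnerMetric J φ p g₁ g₂ g₃)
        (quarterConnection model4 (kasnerMetric J φ p g₁ g₂ g₃) (ddt J) l₁ l₂) α ↔
      ∀ t ∈ (J : Set ℝ), (∑ i, (p i * deriv (logDeriv φ) t + (p i * logDeriv φ t) ^ 2
          - l₂ * (p i * logDeriv φ t) + l₁ * l₂ - l₁ ^ 2) = -α) ∧
        ∀ i, p i * deriv (logDeriv φ) t + (p i * logDeriv φ t) ^ 2
          - l₁ * (p i * logDeriv φ t) - l₂ ^ 2 + l₁ * l₂
          + (p i * logDeriv φ t - l₂)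
            * (∑ j, (p j * logDeriv φ t - l₁) - (p i * logDeriv φ t - l₁)) = -α := by
  have : IsManifold model4 1 (J × F₁ × F₂ × F₃) :=
    IsManifold.of_le (n := ∞) (by exact_mod_cast le_top)
  have hcoord : ∀ x : J × F₁ × F₂ × F₃, (extChartAt model4 x x).1 = x.1 := by
    intro x; rw [extChartAt_model4]; rfl
  have hA : ∀ (x : J × F₁ × F₂ × F₃) i, 0 < φ x.1 ^ (2 * p i)
      * fibreCoeff J g₁ g₂ g₃ x i (spaceCoord i (extChartAt model4 x x)) := fun x i =>
    mul_pos (Real.rpow_pos_of_pos (hφpos _ x.1.2) _)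
      (contDiffAt_fibreCoeff_and_pos J g₁ g₂ g₃ x (mem_extChartAt_target x) i).2
  simp only [isEinsteinWith_iff, ricci_quarterConnection_kasner J hφ hφpos,
    metricInChart_kasnerMetric J φ p g₁ g₂ g₃ _ (mem_extChartAt_target _), warpedMetric_apply,
    hcoord]
  constructor
  · intro H t ht
    obtain ⟨y₁⟩ := ‹Nonempty F₁›
    obtain ⟨y₂⟩ := ‹Nonempty F₂›
    obtain ⟨y₃⟩ := ‹Nonempty F₃›
    have H := H (⟨t, ht⟩, y₁, y₂, y₃)
    have hA := hA (⟨t, ht⟩, y₁, y₂, y₃)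
    constructor
    -- Both tensors are diagonal, so the basis vectors give all the equations; the sign of `-α`
    -- comes from `g(∂/∂t, ∂/∂t) = -1` here, and from the minus sign before the space part of Ricci
    -- in the other case.
    · have h := H timeVec timeVec
      simp only [timeVec, Fin.sum_univ_three, spaceCoord_zero, spaceCoord_one, spaceCoord_two]
        at h ⊢
      linear_combination h
    · intro i
      refine mul_right_cancel₀ (hA i).ne' ?_
      have h := H (spaceVec i) (spaceVec i)
      fin_cases i <;>
      · simp only [Fin.zero_eta, Fin.mk_one, Fin.reduceFinMk, spaceVec_zero, spaceVec_one,
          spaceVec_two, Fin.sum_univ_three, spaceCoord_zero, spaceCoord_one, spaceCoord_two]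
          at h ⊢
        linear_combination -h
  · intro H x u w
    obtain ⟨h0, h1⟩ := H x.1 x.1.2
    rw [h0, Finset.sum_congr rfl fun i _ => by rw [h1 i]]
    simp only [Fin.sum_univ_three]
    ring

end KasnerRicci

end QuarterSymmetric

end

theorem theorem4p20
    (J : TopologicalSpace.Opens ℝ) (hJne : (J : Set ℝ).Nonempty) (hJ : (J : Set ℝ).OrdConnected)
    {F₁ : Type*} [TopologicalSpace F₁] [ChartedSpace ℝ F₁] [IsManifold 𝓘(ℝ, ℝ) ∞ F₁] [Nonempty F₁]
    {F₂ : Type*} [TopologicalSpace F₂] [ChartedSpace ℝ F₂] [IsManifold 𝓘(ℝ, ℝ) ∞ F₂] [Nonempty F₂]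
    {F₃ : Type*} [TopologicalSpace F₃] [ChartedSpace ℝ F₃] [IsManifold 𝓘(ℝ, ℝ) ∞ F₃] [Nonempty F₃]
    (g₁ : QuarterSymmetric.RiemMetric F₁) (g₂ : QuarterSymmetric.RiemMetric F₂)
    (g₃ : QuarterSymmetric.RiemMetric F₃)
    (φ : ℝ → ℝ) (hφ : ContDiffOn ℝ ∞ φ J) (hφpos : ∀ t ∈ J, 0 < φ t)
    (p : Fin 3 → ℝ) (hp : ∀ i j, i ≠ j → p i ≠ p j)
    (l₁ l₂ : ℝ) (hl₁ : l₁ ≠ 0) (hl₂ : l₂ ≠ 0)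
    (ζ η : ℝ) (hζ : ζ = ∑ i, p i) (hη : η = ∑ i, p i ^ 2) (α : ℝ) :
    QuarterSymmetric.IsEinsteinWith QuarterSymmetric.model4
        (QuarterSymmetric.kasnerMetric J φ p g₁ g₂ g₃)
        (QuarterSymmetric.quarterConnection QuarterSymmetric.model4
          (QuarterSymmetric.kasnerMetric J φ p g₁ g₂ g₃) (QuarterSymmetric.ddt J) l₁ l₂) α ↔
      (QuarterSymmetric.IsEinsteinWith 𝓘(ℝ, ℝ) g₁.inner
          (QuarterSymmetric.leviCivita 𝓘(ℝ, ℝ) g₁.inner) 0 ∧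
        QuarterSymmetric.IsEinsteinWith 𝓘(ℝ, ℝ) g₂.inner
          (QuarterSymmetric.leviCivita 𝓘(ℝ, ℝ) g₂.inner) 0 ∧
        QuarterSymmetric.IsEinsteinWith 𝓘(ℝ, ℝ) g₃.inner
          (QuarterSymmetric.leviCivita 𝓘(ℝ, ℝ) g₃.inner) 0) ∧
      ((l₂ ^ 2 = 3 * l₁ ^ 2 ∧ α = 3 * l₁ ^ 2 - 3 * l₁ * l₂ ∧ α = l₂ ^ 2 - 3 * l₁ * l₂ ∧
          ζ = 0 ∧ η = 0) ∨
        (l₂ ^ 2 = 3 * l₁ ^ 2 ∧ α = 3 * l₁ ^ 2 - 3 * l₁ * l₂ ∧ α = l₂ ^ 2 - 3 * l₁ * l₂ ∧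
          η ≠ 0 ∧ ∃ c : ℝ, ∀ t ∈ J, φ t = c) ∨
        (l₂ ≠ 3 * l₁ ∧ α = 0 ∧ ζ ≠ 0 ∧
          η / ζ ^ 2 = (3 * l₁ ^ 2 - l₂ ^ 2) / (3 * l₁ - l₂) ^ 2 ∧
          ∃ c : ℝ, ∀ t ∈ J, φ t = c * Real.exp ((3 * l₁ - l₂) / ζ * t))) := by
  have hη0 : 0 < η := by
    rw [hη]
    refine lt_of_le_of_ne (Finset.sum_nonneg fun i _ => sq_nonneg _) fun h => ?_
    have h' := (Finset.sum_eq_zero_iff_of_nonneg fun i _ => sq_nonneg (p i)).1 h.symm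
    have h0 : ∀ i, p i = 0 := fun i => by simpa using h' i (Finset.mem_univ i)
    exact hp 0 1 (by simp) ((h0 0).trans (h0 1).symm)
  -- The fibre conditions hold automatically in dimension one, so they drop out of the equivalence.
  rw [and_iff_right ⟨QuarterSymmetric.isEinsteinWith_leviCivita_real g₁,
      QuarterSymmetric.isEinsteinWith_leviCivita_real g₂,
      QuarterSymmetric.isEinsteinWith_leviCivita_real g₃⟩,
    QuarterSymmetric.isEinsteinWith_kasner_iff J hφ hφpos]
  refine Iff.trans ?_
    (QuarterSymmetric.kasner_solutions_iff J.isOpen hJne hJ hφ hφpos hl₁ hl₂ hη0)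
  rw [hζ, hη]
  exact forall₂_congr fun t _ =>
    QuarterSymmetric.einstein_equations_iff (hp 0 1 (by simp)) l₁ l₂ α _ _
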